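/- Let $A$ be an associative ring with unit and let $\mathfrak C$ be an $A$-coring, i.e. an $A$-bimodule with $A$-bilinear maps $\Delta_{\mathfrak C}:\mathfrak C\to\mathfrak C\otimes_A\mathfrak C$ and $\varepsilon_{\mathfrak C}:\mathfrak C\to A$ that are coassociative and counital. Let $R$ be a firm ring, i.e. a ring, not necessarily with unit, whose multiplication map $R\otimes_R R\to R$ is bijective. Let $\Sigma$ be an $R$-$A$-bimodule with a right $\mathfrak C$-comodule structure $\rho:\Sigma\to\Sigma\otimes_A\mathfrak C$, $\rho(u)=u_{[0]}\otimes_A u_{[1]}$ (right $A$-linear, coassociative, counital), that is left $R$-linear. Put $\Sigma^*=\mathrm{Hom}_A(\Sigma,A)$, and regard $\Sigma\otimes_A\Sigma^*$ as a (non-unital) ring with multiplication $(u\otimes\varphi)(v\otimes\psi)=u\varphi(v)\otimes\psi$, acting on $\Sigma$ by $(u\otimes\varphi)v=u\varphi(v)$. For a right $A$-module $M$, let $R$ act on the right of $\mathrm{Hom}_A(\Sigma,M)$ by $(fr)(u)=f(ru)$. Assume that $\Sigma$ is $R$-firmly projective: there is a ring morphism $\iota:R\to\Sigma\otimes_A\Sigma^*$,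 written $\iota(r)=e_r\otimes_A f_r$ (summation understood), which induces the given action of $R$ on $\Sigma$, and $\Sigma$ is a firm left $R$-module, i.e. the multiplication map $R\otimes_R\Sigma\to\Sigma$ is bijective. Write its inverse as $u\mapsto r\otimes_R u^r$. Then $\Sigma^*\otimes_R\Sigma$ is an $A$-coring (the comatrix coring) with $$\Delta(\varphi\otimes_R u)=(\varphi\otimes_R e_r)\otimes_A(f_r\otimes_R u^r),\qquad \varepsilon(\varphi\otimes_R u)=\varphi(u).$$ The following are equivalent: (i) $\Sigma$ is an $R$-$\mathfrak C$ Galois comodule, i.e. the canonical map $$\mathsf{can}:\Sigma^*\otimes_R\Sigma\to\mathfrak C,\qquad \mathsf{can}(f\otimes_R u)=f(u_{[0]})u_{[1]},$$ is an isomorphism of $A$-corings; (ii) $\Sigma$ is an $R$-$\mathfrak C$ comonadic-Galois comodule, i.e. for every right $A$-module $M$ the map $$\mathsf{can}_M:\mathrm{Hom}_A(\Sigma,M)\otimes_R\Sigma\to M\otimes_A\mathfrak C,\qquad \mathsf{can}_M(f\otimes_R u)=f(u_{[0]})\otimes_A u_{[1]},$$ is an isomorphism. -/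

import Mathlib

open scoped TensorProduct
open MulOpposite

set_option linter.unusedSectionVars false

namespace FirmGalois

/-! ### Balanced tensor products over an arbitrary (non-commutative, possibly non-unital) ring

Right actions of `S` are written as actions of `Sᵐᵒᵖ`, so `op s • m` is the product `m s`. -/

section Balanced

universe s v w

variable (S : Type s) (M : Type v) (N : Type w) [AddCommGroup M] [AddCommGroup N]
  [SMul Sᵐᵒᵖ M] [SMul S N]

/-- The subgroup of `M ⊗[ℤ] N` generated by all `m s ⊗ n - m ⊗ s n`. -/
def balancedRel : AddSubgroup (M ⊗[ℤ] N) :=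
  AddSubgroup.closure
    {x | ∃ (s : S) (m : M) (n : N), x = (op s • m) ⊗ₜ[ℤ] n - m ⊗ₜ[ℤ] (s • n)}

/-- The tensor product `M ⊗_S N` of a right `S`-module `M` and a left `S`-module `N`. -/
def BTensor : Type (max v w) := (M ⊗[ℤ] N) ⧸ balancedRel S M N

instance : AddCommGroup (BTensor S M N) :=
  inferInstanceAs (AddCommGroup ((M ⊗[ℤ] N) ⧸ balancedRel S M N))

/-- The canonical projection `M ⊗[ℤ] N → M ⊗_S N`. -/
def bproj : M ⊗[ℤ] N →+ BTensor S M N := QuotientAddGroup.mk' (balancedRel S M N)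

variable {M N}

/-- The pure tensor `m ⊗_S n`. -/
def btmul (m : M) (n : N) : BTensor S M N :=
  bproj S M N (m ⊗ₜ[ℤ] n)

theorem btmul_balanced (s : S) (m : M) (n : N) :
    btmul S (op s • m) n = btmul S m (s • n) := by
  rw [← sub_eq_zero]
  unfold btmul
  rw [← map_sub]
  exact (QuotientAddGroup.eq_zero_iff _).2 (AddSubgroup.subset_closure ⟨s, m, n, rfl⟩)

theorem add_btmul (m m' : M) (n : N) :
    btmul S (m + m') n = btmul S m n + btmul S m' n := by
  unfold btmul
  rw [TensorProduct.add_tmul, map_add]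

theorem btmul_add (m : M) (n n' : N) :
    btmul S m (n + n') = btmul S m n + btmul S m n' := by
  unfold btmul
  rw [TensorProduct.tmul_add, map_add]

theorem btmul_zero (m : M) : btmul S m (0 : N) = 0 := by
  unfold btmul
  rw [TensorProduct.tmul_zero, map_zero]

theorem zero_btmul (n : N) : btmul S (0 : M) n = 0 := by
  unfold btmul
  rw [TensorProduct.zero_tmul, map_zero]

theorem btensor_induction {p : BTensor S M N → Prop} (x : BTensor S M N)
    (h0 : p 0) (ht : ∀ m n, p (btmul S m n)) (ha : ∀ x y, p x → p y → p (x + y)) : p x := by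
  obtain ⟨y, rfl⟩ : ∃ y, bproj S M N y = x :=
    QuotientAddGroup.mk'_surjective (balancedRel S M N) x
  induction y with
  | zero => rw [map_zero]; exact h0
  | tmul m n => exact ht m n
  | add a b iha ihb => rw [map_add]; exact ha _ _ iha ihb

variable {P : Type*} [AddCommGroup P]

/-- The universal property of `M ⊗_S N`. -/
def blift (f : M → N → P) (hl : ∀ m m' n, f (m + m') n = f m n + f m' n)
    (hr : ∀ m n n', f m (n + n') = f m n + f m n')
    (hb : ∀ (s : S) m n, f (op s • m) n = f m (s • n)) : BTensor S M N →+ P :=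
  QuotientAddGroup.lift (balancedRel S M N)
    (TensorProduct.liftAddHom (R := ℤ)
      (AddMonoidHom.mk' (fun m => AddMonoidHom.mk' (f m) (hr m))
        (fun m m' => by ext n; exact hl m m' n))
      (fun z m n => by rw [map_zsmul, map_zsmul]; rfl))
    (by
      unfold balancedRel
      rw [AddSubgroup.closure_le]
      rintro _ ⟨s, m, n, rfl⟩
      have h := hb s m n
      simp only [SetLike.mem_coe, AddMonoidHom.mem_ker, map_sub,
        TensorProduct.liftAddHom_tmul, AddMonoidHom.mk'_apply, h, sub_self])

@[simp]
theorem blift_btmul (f : M → N → P) (hl hr) (hb : ∀ (s : S) m n, f (op s • m) n = f m (s • n))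
    (m : M) (n : N) : blift S f hl hr hb (btmul S m n) = f m n := rfl

theorem btensor_hom_ext {f g : BTensor S M N →+ P}
    (h : ∀ m n, f (btmul S m n) = g (btmul S m n)) : f = g := by
  ext x
  induction x using btensor_induction with
  | h0 => simp
  | ht m n => exact h m n
  | ha x y hx hy => rw [map_add, map_add, hx, hy]

end Balanced

section Actions

variable (S : Type*) {M N T : Type*} [AddCommGroup M] [AddCommGroup N]
  [SMul Sᵐᵒᵖ M] [SMul S N] [Ring T]

/-- If `M` is a `T`-`S`-bimodule, then `M ⊗_S N` is a left `T`-module, `t (m ⊗ n) = t m ⊗ n`. -/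
instance leftModule [Module T M] [SMulCommClass T Sᵐᵒᵖ M] : Module T (BTensor S M N) where
  smul t := blift S (fun m n => btmul S (t • m) n)
    (fun m m' n => by rw [smul_add, add_btmul]) (fun m n n' => btmul_add S _ n n')
    (fun s m n => by rw [smul_comm, btmul_balanced])
  one_smul x := by
    change blift S _ _ _ _ x = x
    induction x using btensor_induction with
    | h0 => simp
    | ht m n => simp
    | ha x y hx hy => rw [map_add, hx, hy]
  mul_smul t t' x := by
    change blift S _ _ _ _ x = blift S _ _ _ _ (blift S _ _ _ _ x)
    induction x using btensor_induction with
    | h0 => simp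
    | ht m n => simp [mul_smul]
    | ha x y hx hy => simp only [map_add, hx, hy]
  smul_zero t := map_zero (blift S _ _ _ _)
  smul_add t x y := map_add (blift S _ _ _ _) x y
  add_smul t t' x := by
    change blift S _ _ _ _ x = blift S _ _ _ _ x + blift S _ _ _ _ x
    induction x using btensor_induction with
    | h0 => simp
    | ht m n => simp [add_smul, add_btmul]
    | ha x y hx hy => simp only [map_add, hx, hy]; abel
  zero_smul x := by
    change blift S _ _ _ _ x = 0
    induction x using btensor_induction with
    | h0 => simp
    | ht m n =>
      rw [blift_btmul, zero_smul, zero_btmul]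
    | ha x y hx hy => rw [map_add, hx, hy, add_zero]

/-- If `N` is an `S`-`T`-bimodule, then `M ⊗_S N` is a right `T`-module, `(m ⊗ n) t = m ⊗ n t`. -/
instance rightModule [Module Tᵐᵒᵖ N] [SMulCommClass S Tᵐᵒᵖ N] :
    Module Tᵐᵒᵖ (BTensor S M N) where
  smul t := blift S (fun m n => btmul S m (t • n))
    (fun m m' n => add_btmul S m m' _) (fun m n n' => by rw [smul_add, btmul_add])
    (fun s m n => by rw [btmul_balanced, smul_comm])
  one_smul x := by
    change blift S _ _ _ _ x = x
    induction x using btensor_induction with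
    | h0 => simp
    | ht m n => simp
    | ha x y hx hy => rw [map_add, hx, hy]
  mul_smul t t' x := by
    change blift S _ _ _ _ x = blift S _ _ _ _ (blift S _ _ _ _ x)
    induction x using btensor_induction with
    | h0 => simp
    | ht m n => simp [mul_smul]
    | ha x y hx hy => simp only [map_add, hx, hy]
  smul_zero t := map_zero (blift S _ _ _ _)
  smul_add t x y := map_add (blift S _ _ _ _) x y
  add_smul t t' x := by
    change blift S _ _ _ _ x = blift S _ _ _ _ x + blift S _ _ _ _ x
    induction x using btensor_induction with
    | h0 => simp
    | ht m n => simp [add_smul, btmul_add]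
    | ha x y hx hy => simp only [map_add, hx, hy]; abel
  zero_smul x := by
    change blift S _ _ _ _ x = 0
    induction x using btensor_induction with
    | h0 => simp
    | ht m n =>
      rw [blift_btmul, zero_smul, btmul_zero]
    | ha x y hx hy => rw [map_add, hx, hy, add_zero]

theorem smul_btmul [Module T M] [SMulCommClass T Sᵐᵒᵖ M] (t : T) (m : M) (n : N) :
    t • btmul S m n = btmul S (t • m) n := rfl

theorem op_smul_btmul [Module Tᵐᵒᵖ N] [SMulCommClass S Tᵐᵒᵖ N] (t : T) (m : M) (n : N) :
    op t • btmul S m n = btmul S m (op t • n) := rfl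

instance {T' : Type*} [Ring T'] [Module T M] [SMulCommClass T Sᵐᵒᵖ M]
    [Module T'ᵐᵒᵖ N] [SMulCommClass S T'ᵐᵒᵖ N] :
    SMulCommClass T T'ᵐᵒᵖ (BTensor S M N) where
  smul_comm t t' x := by
    induction x using btensor_induction with
    | h0 => simp only [smul_zero]
    | ht m n => rfl
    | ha x y hx hy => simp only [smul_add, hx, hy]

end Actions

/-! ### Tensor products over a unital ring `A` -/

section Unital

/-- The tensor product `M ⊗_A N` of unital modules over a unital ring `A`. -/
abbrev ATensor (A M N : Type*) [Ring A] [AddCommGroup M] [AddCommGroup N]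
    [Module Aᵐᵒᵖ M] [Module A N] : Type _ := BTensor A M N

variable {A : Type*} [Ring A]
variable {M M' M'' N N' N'' : Type*}
  [AddCommGroup M] [AddCommGroup M'] [AddCommGroup M'']
  [AddCommGroup N] [AddCommGroup N'] [AddCommGroup N'']
  [Module Aᵐᵒᵖ M] [Module Aᵐᵒᵖ M'] [Module Aᵐᵒᵖ M'']
  [Module A N] [Module A N'] [Module A N'']

/-- The map `f ⊗_A g` for a right `A`-linear `f` and a left `A`-linear `g`. -/
def bmap (f : M →ₗ[Aᵐᵒᵖ] M') (g : N →ₗ[A] N') : ATensor A M N →+ ATensor A M' N' :=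
  blift A (fun m n => btmul A (f m) (g n))
    (fun m m' n => by rw [map_add, add_btmul]) (fun m n n' => by rw [map_add, btmul_add])
    (fun a m n => by rw [map_smul, map_smul, btmul_balanced])

@[simp]
theorem bmap_btmul (f : M →ₗ[Aᵐᵒᵖ] M') (g : N →ₗ[A] N') (m : M) (n : N) :
    bmap f g (btmul A m n) = btmul A (f m) (g n) := rfl

/-- The canonical map `(M ⊗_A X) ⊗_A N → M ⊗_A (X ⊗_A N)`, `(m ⊗ x) ⊗ n ↦ m ⊗ (x ⊗ n)`. -/
def bassoc (M X N : Type*) [AddCommGroup M] [AddCommGroup X] [AddCommGroup N]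
    [Module Aᵐᵒᵖ M] [Module A X] [Module Aᵐᵒᵖ X] [SMulCommClass A Aᵐᵒᵖ X] [Module A N] :
    ATensor A (ATensor A M X) N →+ ATensor A M (ATensor A X N) :=
  blift A
    (fun z n => blift A (fun m x => btmul A m (btmul A x n))
      (fun m m' x => add_btmul A m m' _)
      (fun m x x' => by rw [add_btmul, btmul_add])
      (fun a m x => by rw [btmul_balanced, smul_btmul]) z)
    (fun z z' n => map_add _ z z')
    (fun z n n' => by
      induction z using btensor_induction with
      | h0 => simp
      | ht m x => simp [btmul_add]
      | ha x y hx hy => simp only [map_add, hx, hy]; abel)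
    (fun a z n => by
      induction z using btensor_induction with
      | h0 => simp
      | ht m x => simp [op_smul_btmul, btmul_balanced]
      | ha x y hx hy => simp only [smul_add, map_add, hx, hy])

@[simp]
theorem bassoc_btmul {X : Type*} [AddCommGroup X] [Module A X] [Module Aᵐᵒᵖ X]
    [SMulCommClass A Aᵐᵒᵖ X] (m : M) (x : X) (n : N) :
    bassoc (A := A) M X N (btmul A (btmul A m x) n) = btmul A m (btmul A x n) := rfl

/-- The canonical map `A ⊗_A N → N`, `a ⊗ n ↦ a n`. -/
def lunit (N : Type*) [AddCommGroup N] [Module A N] : ATensor A A N →+ N :=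
  blift A (fun a n => a • n) (fun a a' n => add_smul a a' n) (fun a n n' => smul_add a n n')
    (fun s a n => by rw [op_smul_eq_mul, mul_smul])

@[simp]
theorem lunit_btmul (a : A) (n : N) : lunit (A := A) N (btmul A a n) = a • n := rfl

/-- The canonical map `M ⊗_A A → M`, `m ⊗ a ↦ m a`. -/
def runit (M : Type*) [AddCommGroup M] [Module Aᵐᵒᵖ M] : ATensor A M A →+ M :=
  blift A (fun m a => op a • m) (fun m m' a => smul_add _ m m')
    (fun m a a' => by rw [op_add, add_smul])
    (fun s m a => by rw [smul_eq_mul, op_mul, mul_smul])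

@[simp]
theorem runit_btmul (m : M) (a : A) : runit (A := A) M (btmul A m a) = op a • m := rfl

end Unital

/-! ### Bimodule maps, corings, comodules -/

/-- `A`-bilinear maps between `A`-bimodules. -/
structure BimodHom (A M N : Type*) [Ring A] [AddCommGroup M] [AddCommGroup N]
    [Module A M] [Module Aᵐᵒᵖ M] [Module A N] [Module Aᵐᵒᵖ N] extends M →ₗ[A] N where
  map_op_smul' : ∀ (a : A) (m : M), toFun (op a • m) = op a • toFun m

namespace BimodHom

variable {A M N : Type*} [Ring A] [AddCommGroup M] [AddCommGroup N]
    [Module A M] [Module Aᵐᵒᵖ M] [Module A N] [Module Aᵐᵒᵖ N]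

instance : CoeFun (BimodHom A M N) (fun _ => M → N) := ⟨fun f => f.toFun⟩

theorem map_zero (f : BimodHom A M N) : f 0 = 0 := _root_.map_zero f.toLinearMap

theorem map_add (f : BimodHom A M N) (x y : M) : f (x + y) = f x + f y :=
  _root_.map_add f.toLinearMap x y

/-- The underlying left `A`-linear map. -/
abbrev left (f : BimodHom A M N) : M →ₗ[A] N := f.toLinearMap

/-- The underlying right `A`-linear map. -/
def right (f : BimodHom A M N) : M →ₗ[Aᵐᵒᵖ] N where
  toFun := f
  map_add' := f.map_add'
  map_smul' a m := f.map_op_smul' (unop a) m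

end BimodHom

section Corings

variable (A : Type*) [Ring A] (C : Type*) [AddCommGroup C] [Module A C] [Module Aᵐᵒᵖ C]
  [SMulCommClass A Aᵐᵒᵖ C]

/-- The structure of an `A`-coring on an `A`-bimodule `C`. -/
structure Coring where
  /-- comultiplication -/
  comul : BimodHom A C (ATensor A C C)
  /-- counit -/
  counit : BimodHom A C A
  coassoc : ∀ c, bassoc (A := A) C C C (bmap comul.right LinearMap.id (comul c)) =
    bmap LinearMap.id comul.left (comul c)
  counit_left : ∀ c, lunit (A := A) C (bmap counit.right LinearMap.id (comul c)) = c
  counit_right : ∀ c, runit (A := A) C (bmap LinearMap.id counit.left (comul c)) = c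

variable {A C}

/-- The structure of a right `𝒞`-comodule on a right `A`-module `X`. -/
structure Comodule (𝒞 : Coring A C) (X : Type*) [AddCommGroup X] [Module Aᵐᵒᵖ X] where
  /-- coaction -/
  coact : X →ₗ[Aᵐᵒᵖ] ATensor A X C
  coassoc : ∀ x, bassoc (A := A) X C C (bmap coact LinearMap.id (coact x)) =
    bmap LinearMap.id 𝒞.comul.left (coact x)
  counit : ∀ x, runit (A := A) X (bmap LinearMap.id 𝒞.counit.left (coact x)) = x

/-- A bimodule map `f` between corings is a morphism of corings. -/
structure IsCoringHom {D : Type*} [AddCommGroup D] [Module A D] [Module Aᵐᵒᵖ D]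
    [SMulCommClass A Aᵐᵒᵖ D] (𝒟 : Coring A D) (𝒞 : Coring A C) (f : BimodHom A D C) : Prop where
  map_comul : ∀ d, 𝒞.comul (f d) = bmap f.right f.left (𝒟.comul d)
  map_counit : ∀ d, 𝒞.counit (f d) = 𝒟.counit d

end Corings

/-! ### Firm rings and firm modules -/

/-- Left modules over a ring without unit. -/
class NonUnitalModule (R M : Type*) [NonUnitalRing R] [AddCommGroup M] extends SMul R M where
  protected smul_add : ∀ (r : R) (m m' : M), r • (m + m') = r • m + r • m'
  protected add_smul : ∀ (r r' : R) (m : M), (r + r') • m = r • m + r' • m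
  protected mul_smul : ∀ (r r' : R) (m : M), (r * r') • m = r • r' • m

/-- The regular left module of a ring without unit. -/
instance (R : Type*) [NonUnitalRing R] : NonUnitalModule R R where
  smul_add := mul_add
  add_smul := add_mul
  mul_smul := mul_assoc

section Firm

variable (R : Type*) [NonUnitalRing R]

/-- The multiplication map `R ⊗_R M → M`. -/
def actionMap (M : Type*) [AddCommGroup M] [NonUnitalModule R M] : BTensor R R M →+ M :=
  blift R (fun r m => r • m) NonUnitalModule.add_smul NonUnitalModule.smul_add
    (fun s r m => by rw [op_smul_eq_mul, NonUnitalModule.mul_smul])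

/-- `M` is a firm left `R`-module. -/
def IsFirmModule (M : Type*) [AddCommGroup M] [NonUnitalModule R M] : Prop :=
  Function.Bijective (actionMap R M)

/-- `R` is a firm ring: the multiplication `R ⊗_R R → R` is bijective. -/
def IsFirmRing : Prop := IsFirmModule R R

end Firm

/-! ### The dual, the elementary ring, firm projectivity -/

section Bimodule

variable {A R X : Type*} [Ring A] [NonUnitalRing R] [AddCommGroup X]
  [Module Aᵐᵒᵖ X] [NonUnitalModule R X] [SMulCommClass R Aᵐᵒᵖ X]

/-- On an `R`-`A`-bimodule `X`, the right `A`-linear map `x ↦ r x`. -/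
def lact (A : Type*) {R X : Type*} [Ring A] [NonUnitalRing R] [AddCommGroup X]
    [Module Aᵐᵒᵖ X] [NonUnitalModule R X] [SMulCommClass R Aᵐᵒᵖ X] (r : R) : X →ₗ[Aᵐᵒᵖ] X where
  toFun x := r • x
  map_add' := NonUnitalModule.smul_add r
  map_smul' a x := smul_comm r a x

@[simp]
theorem lact_apply (r : R) (x : X) : lact A r x = r • x := rfl

/-- The right `R`-action on `Hom_A(X, M)`: `(f r)(x) = f (r x)`. -/
instance homRightAction {M : Type*} [AddCommGroup M] [Module Aᵐᵒᵖ M] :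
    SMul Rᵐᵒᵖ (X →ₗ[Aᵐᵒᵖ] M) where
  smul r f := f.comp (lact A (unop r))

theorem hom_op_smul_apply {M : Type*} [AddCommGroup M] [Module Aᵐᵒᵖ M] (r : R)
    (f : X →ₗ[Aᵐᵒᵖ] M) (x : X) : (op r • f) x = f (r • x) := rfl

instance {M : Type*} [AddCommGroup M] [Module A M] [Module Aᵐᵒᵖ M] [SMulCommClass A Aᵐᵒᵖ M]
    [SMulCommClass Aᵐᵒᵖ A M] : SMulCommClass A Rᵐᵒᵖ (X →ₗ[Aᵐᵒᵖ] M) where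
  smul_comm _ _ _ := rfl

end Bimodule

section Elementary

variable (A : Type*) [Ring A] (X : Type*) [AddCommGroup X] [Module Aᵐᵒᵖ X]

/-- The dual `X^* = Hom_A(X, A)` of a right `A`-module, a left `A`-module by `(a f)(x) = a f(x)`. -/
abbrev Dual : Type _ := X →ₗ[Aᵐᵒᵖ] A

/-- The underlying additive group of the elementary ring `Z = X ⊗_A X^*`. -/
abbrev Elem : Type _ := ATensor A X (Dual A X)

variable {A X}

/-- The rank one map `v ↦ u φ(v)`. -/
def rankOne (u : X) (φ : Dual A X) : X →ₗ[Aᵐᵒᵖ] X where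
  toFun v := op (φ v) • u
  map_add' v w := by rw [map_add, op_add, add_smul]
  map_smul' a v := by
    rw [map_smul, RingHom.id_apply, ← mul_smul]
    rfl

@[simp]
theorem rankOne_apply (u : X) (φ : Dual A X) (v : X) : rankOne u φ v = op (φ v) • u := rfl

/-- The action of `Z = X ⊗_A X^*` on `X`: `(u ⊗ φ) v = u φ(v)`. -/
def elemAct : Elem A X →+ (X →ₗ[Aᵐᵒᵖ] X) :=
  blift A rankOne
    (fun u u' φ => by ext v; simp)
    (fun u φ ψ => by ext v; simp [add_smul])
    (fun a u φ => by ext v; simp [mul_smul])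

@[simp]
theorem elemAct_btmul (u : X) (φ : Dual A X) (v : X) :
    elemAct (btmul A u φ) v = op (φ v) • u := rfl

/-- Multiplication on `Z`: `z (v ⊗ ψ) = (z v) ⊗ ψ`; in particular
`(u ⊗ φ)(v ⊗ ψ) = u φ(v) ⊗ ψ`. -/
def elemMul (z w : Elem A X) : Elem A X := bmap (elemAct z) LinearMap.id w

theorem elemMul_btmul (z : Elem A X) (v : X) (ψ : Dual A X) :
    elemMul z (btmul A v ψ) = btmul A (elemAct z v) ψ := rfl

theorem elemMul_add (z w w' : Elem A X) : elemMul z (w + w') = elemMul z w + elemMul z w' :=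
  map_add _ w w'

theorem add_elemMul (z z' w : Elem A X) : elemMul (z + z') w = elemMul z w + elemMul z' w := by
  induction w using btensor_induction with
  | h0 => simp [elemMul]
  | ht v ψ => simp only [elemMul_btmul, map_add, LinearMap.add_apply, add_btmul]
  | ha x y hx hy => simp only [elemMul_add, hx, hy]; abel

theorem elemAct_mul (z w : Elem A X) (x : X) :
    elemAct (elemMul z w) x = elemAct z (elemAct w x) := by
  induction w using btensor_induction with
  | h0 => simp [elemMul]
  | ht v ψ => rw [elemMul_btmul, elemAct_btmul, elemAct_btmul, map_smul]
  | ha u v hu hv => simp only [elemMul_add, map_add, LinearMap.add_apply, hu, hv]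

/-- The elementary ring `Z = X ⊗_A X^*`, in general without unit. -/
instance : NonUnitalRing (Elem A X) where
  mul := elemMul
  left_distrib := elemMul_add
  right_distrib := add_elemMul
  zero_mul w := by
    change elemMul 0 w = 0
    have h := add_elemMul 0 0 w
    rwa [add_zero, left_eq_add] at h
  mul_zero z := map_zero (bmap (elemAct z) LinearMap.id)
  mul_assoc z w y := by
    change elemMul (elemMul z w) y = elemMul z (elemMul w y)
    induction y using btensor_induction with
    | h0 => exact (map_zero (bmap _ _)).trans (map_zero (bmap _ _)).symm
    | ht v ψ => simp only [elemMul_btmul, elemAct_mul]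
    | ha u v hu hv => simp only [elemMul_add, hu, hv]

theorem btmul_mul_btmul (u v : X) (φ ψ : Dual A X) :
    (btmul A u φ * btmul A v ψ : Elem A X) = btmul A (op (φ v) • u) ψ := rfl

variable (A X)

/-- A witness that the `R`-`A`-bimodule `X` is `R`-firmly projective: a ring morphism
`ι : R → X ⊗_A X^*` inducing the given `R`-action on `X`, for which `X` is firm. -/
structure FirmlyProjective (R : Type*) [NonUnitalRing R] [NonUnitalModule R X] where
  /-- the ring morphism -/
  ι : R →ₙ+* Elem A X
  act_eq : ∀ (r : R) (x : X), elemAct (ι r) x = r • x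
  firm : IsFirmModule R X

end Elementary

/-! ### The comatrix coring -/

section Comatrix

variable (A R X : Type*) [Ring A] [NonUnitalRing R] [AddCommGroup X]
  [Module Aᵐᵒᵖ X] [NonUnitalModule R X] [SMulCommClass R Aᵐᵒᵖ X]

/-- The `A`-bimodule `X^* ⊗_R X`. -/
abbrev Comatrix : Type _ := BTensor R (Dual A X) X

variable {A R X}

/-- For `φ ∈ Hom_A(X, M)`, the right `A`-linear map `X → Hom_A(X, M) ⊗_R X`, `u ↦ φ ⊗ u`. -/
def tensL {M : Type*} [AddCommGroup M] [Module Aᵐᵒᵖ M] (φ : X →ₗ[Aᵐᵒᵖ] M) :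
    X →ₗ[Aᵐᵒᵖ] BTensor R (X →ₗ[Aᵐᵒᵖ] M) X where
  toFun u := btmul R φ u
  map_add' := btmul_add R φ
  map_smul' _ _ := rfl

/-- For `u ∈ X`, the left `A`-linear map `X^* → X^* ⊗_R X`, `f ↦ f ⊗ u`. -/
def tensR (u : X) : Dual A X →ₗ[A] Comatrix A R X where
  toFun f := btmul R f u
  map_add' f g := add_btmul R f g u
  map_smul' _ _ := rfl

@[simp]
theorem tensL_apply {M : Type*} [AddCommGroup M] [Module Aᵐᵒᵖ M] (φ : X →ₗ[Aᵐᵒᵖ] M) (u : X) :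
    tensL (R := R) φ u = btmul R φ u := rfl

@[simp]
theorem tensR_apply (f : Dual A X) (u : X) : tensR (R := R) u f = btmul R f u := rfl

namespace FirmlyProjective

/-- The inverse `d : X → R ⊗_R X` of the multiplication map. -/
noncomputable def d (P : FirmlyProjective A X R) : X ≃+ BTensor R R X :=
  (AddEquiv.ofBijective (actionMap R X) P.firm).symm

theorem d_smul (P : FirmlyProjective A X R) (r : R) (u : X) : P.d (r • u) = btmul R r u := by
  unfold d
  rw [AddEquiv.symm_apply_eq]
  rfl

theorem smul_induction (P : FirmlyProjective A X R) {p : X → Prop} (x : X) (h0 : p 0)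
    (hs : ∀ (r : R) u, p (r • u)) (ha : ∀ x y, p x → p y → p (x + y)) : p x := by
  obtain ⟨z, rfl⟩ := P.d.symm.surjective x
  induction z using btensor_induction with
  | h0 => rw [map_zero]; exact h0
  | ht r u => exact hs r u
  | ha x y hx hy => rw [map_add]; exact ha _ _ hx hy

theorem elemMul_right (P : FirmlyProjective A X R) (z : Elem A X) (s : R) (u : X) :
    bmap LinearMap.id (tensR (R := R) u) (z * P.ι s) =
      bmap LinearMap.id (tensR (R := R) (s • u)) z := by
  induction z using btensor_induction with
  | h0 => rw [zero_mul, map_zero, map_zero]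
  | ht e f =>
    have h : ∀ w : Elem A X, (btmul A e f * w : Elem A X) = btmul A e (f.comp (elemAct w)) := by
      intro w
      induction w using btensor_induction with
      | h0 =>
        rw [mul_zero, map_zero, LinearMap.comp_zero, btmul_zero]
      | ht v ψ =>
        rw [btmul_mul_btmul, btmul_balanced]
        congr 1
        ext x
        simp
      | ha x y hx hy => rw [mul_add, hx, hy, map_add, LinearMap.comp_add, btmul_add]
    have h' : f.comp (elemAct (P.ι s)) = op s • f := by
      ext x
      rw [LinearMap.comp_apply, P.act_eq, hom_op_smul_apply]
    rw [h, h', bmap_btmul, bmap_btmul, tensR_apply, tensR_apply, btmul_balanced]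
  | ha x y hx hy => rw [add_mul, map_add, map_add, hx, hy]

/-- The ring morphism `ι` as an additive map. -/
def ιAdd (P : FirmlyProjective A X R) : R →+ Elem A X := AddMonoidHom.mk' P.ι (map_add P.ι)

theorem elemAct_ιAdd (P : FirmlyProjective A X R) (s : R) : elemAct (P.ιAdd s) = lact A s := by
  ext x
  exact P.act_eq s x

theorem ιAdd_mul (P : FirmlyProjective A X R) (s r : R) :
    P.ιAdd (s * r) = bmap (lact A s) LinearMap.id (P.ιAdd r) := by
  rw [← elemAct_ιAdd]
  exact map_mul P.ι s r

theorem ιAdd_mul_right (P : FirmlyProjective A X R) (r s : R) (u : X) :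
    bmap LinearMap.id (tensR (R := R) u) (P.ιAdd (op s • r)) =
      bmap LinearMap.id (tensR (R := R) (s • u)) (P.ιAdd r) := by
  have h : P.ιAdd (op s • r) = P.ι r * P.ι s := map_mul P.ι r s
  rw [h]
  exact P.elemMul_right (P.ι r) s u

theorem bmap_tensR_smul (a : A) (v : X) (z : Elem A X) :
    bmap LinearMap.id (tensR (R := R) (op a • v)) z =
      op a • bmap LinearMap.id (tensR (R := R) v) z := by
  induction z using btensor_induction with
  | h0 => simp
  | ht e f => rfl
  | ha x y hx hy => simp only [map_add, smul_add, hx, hy]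

theorem bmap_tensL_add (φ ψ : Dual A X) (w : ATensor A X (Comatrix A R X)) :
    bmap (tensL (R := R) (φ + ψ)) LinearMap.id w =
      bmap (tensL (R := R) φ) LinearMap.id w + bmap (tensL (R := R) ψ) LinearMap.id w := by
  induction w using btensor_induction with
  | h0 => simp
  | ht e z => simp [add_btmul]
  | ha x y hx hy => simp only [map_add, hx, hy]; abel

theorem bmap_tensL_smul (a : A) (φ : Dual A X) (w : ATensor A X (Comatrix A R X)) :
    bmap (tensL (R := R) (a • φ)) LinearMap.id w =
      a • bmap (tensL (R := R) φ) LinearMap.id w := by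
  induction w using btensor_induction with
  | h0 => simp
  | ht e z => rfl
  | ha x y hx hy => simp only [map_add, smul_add, hx, hy]

theorem bmap_tensR_add {M : Type*} [AddCommGroup M] [Module Aᵐᵒᵖ M] (u v : X)
    (z : ATensor A M (Dual A X)) :
    bmap LinearMap.id (tensR (R := R) (u + v)) z =
      bmap LinearMap.id (tensR (R := R) u) z + bmap LinearMap.id (tensR (R := R) v) z := by
  induction z using btensor_induction with
  | h0 => simp
  | ht e f => simp [btmul_add]
  | ha x y hx hy => simp only [map_add, hx, hy]; abel

/-- The map `R ⊗_R X → X ⊗_A (X^* ⊗_R X)`, `r ⊗ u ↦ e_r ⊗ (f_r ⊗ u)`, where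
`ι r = e_r ⊗ f_r`. -/
noncomputable def unitMap (P : FirmlyProjective A X R) :
    BTensor R R X →+ ATensor A X (Comatrix A R X) :=
  blift R (fun r u => bmap LinearMap.id (tensR u) (P.ιAdd r))
    (fun r r' u => by rw [map_add, map_add])
    (fun r u u' => bmap_tensR_add u u' _)
    (fun s r u => ιAdd_mul_right P r s u)

theorem unitMap_btmul (P : FirmlyProjective A X R) (r : R) (u : X) :
    P.unitMap (btmul R r u) = bmap LinearMap.id (tensR u) (P.ιAdd r) := rfl

/-- The coaction of the comatrix coring on `X` as an additive map. -/
noncomputable def coactAux (P : FirmlyProjective A X R) : X →+ ATensor A X (Comatrix A R X) :=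
  AddMonoidHom.comp P.unitMap P.d.toAddMonoidHom

theorem coactAux_smul (P : FirmlyProjective A X R) (r : R) (u : X) :
    P.coactAux (r • u) = bmap LinearMap.id (tensR u) (P.ιAdd r) := by
  rw [← P.unitMap_btmul, ← P.d_smul]
  rfl

/-- The coaction `u ↦ e_r ⊗ (f_r ⊗ u^r)` of the comatrix coring on `X`, where
`d u = r ⊗ u^r` and `ι r = e_r ⊗ f_r`. -/
noncomputable def coact (P : FirmlyProjective A X R) :
    X →ₗ[Aᵐᵒᵖ] ATensor A X (Comatrix A R X) where
  toFun := P.coactAux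
  map_add' := map_add _
  map_smul' a u := by
    induction u using P.smul_induction with
    | h0 => simp
    | hs r v =>
      rw [← smul_comm r a v, coactAux_smul, coactAux_smul, RingHom.id_apply]
      exact bmap_tensR_smul (unop a) v _
    | ha x y hx hy => simp only [smul_add, map_add, hx, hy]

theorem coact_smul (P : FirmlyProjective A X R) (r : R) (u : X) :
    P.coact (r • u) = bmap LinearMap.id (tensR u) (P.ιAdd r) := P.coactAux_smul r u

theorem coact_smul_left (P : FirmlyProjective A X R) (s : R) (u : X) :
    P.coact (s • u) = bmap (lact A s) LinearMap.id (P.coact u) := by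
  induction u using P.smul_induction with
  | h0 =>
    have h : s • (0 : X) = 0 := map_zero (lact A s)
    rw [h, map_zero, map_zero]
  | hs r v =>
    rw [← NonUnitalModule.mul_smul, coact_smul, coact_smul, P.ιAdd_mul]
    generalize P.ιAdd r = z
    induction z using btensor_induction with
    | h0 => simp
    | ht e f => rfl
    | ha x y hx hy => simp only [map_add, hx, hy]
  | ha x y hx hy => rw [NonUnitalModule.smul_add, map_add, map_add, map_add, hx, hy]

/-- The comultiplication `φ ⊗ u ↦ (φ ⊗ e_r) ⊗ (f_r ⊗ u^r)` as an additive map. -/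
noncomputable def comulAux (P : FirmlyProjective A X R) :
    Comatrix A R X →+ ATensor A (Comatrix A R X) (Comatrix A R X) :=
  blift R (fun φ u => bmap (tensL φ) LinearMap.id (P.coact u))
    (fun φ φ' u => bmap_tensL_add φ φ' _)
    (fun φ u u' => by rw [map_add, map_add])
    (fun s φ u => by
      rw [coact_smul_left]
      induction P.coact u using btensor_induction with
      | h0 => simp
      | ht e z => simp [btmul_balanced]
      | ha x y hx hy => simp only [map_add, hx, hy])

theorem comulAux_btmul (P : FirmlyProjective A X R) (φ : Dual A X) (u : X) :
    P.comulAux (btmul R φ u) = bmap (tensL φ) LinearMap.id (P.coact u) := rfl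

/-- The comultiplication `φ ⊗ u ↦ (φ ⊗ e_r) ⊗ (f_r ⊗ u^r)` of the comatrix coring. -/
noncomputable def comul (P : FirmlyProjective A X R) :
    BimodHom A (Comatrix A R X) (ATensor A (Comatrix A R X) (Comatrix A R X)) where
  toFun := P.comulAux
  map_add' := map_add _
  map_smul' a z := by
    induction z using btensor_induction with
    | h0 => simp
    | ht φ u =>
      rw [smul_btmul, comulAux_btmul, comulAux_btmul, RingHom.id_apply]
      exact bmap_tensL_smul a φ _
    | ha x y hx hy => simp only [smul_add, map_add, hx, hy]
  map_op_smul' a z := by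
    change P.comulAux _ = _ • P.comulAux _
    induction z using btensor_induction with
    | h0 => simp
    | ht φ u =>
      rw [op_smul_btmul, comulAux_btmul, comulAux_btmul, map_smul]
      induction P.coact u using btensor_induction with
      | h0 => simp
      | ht e z => rfl
      | ha x y hx hy => simp only [map_add, smul_add, hx, hy]
    | ha x y hx hy => simp only [smul_add, map_add, hx, hy]

theorem comul_btmul (P : FirmlyProjective A X R) (φ : Dual A X) (u : X) :
    P.comul (btmul R φ u) = bmap (tensL φ) LinearMap.id (P.coact u) := rfl

end FirmlyProjective

variable (A R X)

/-- The evaluation `X^* ⊗_R X → A`, `φ ⊗ u ↦ φ(u)`. -/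
def evalMap : BimodHom A (Comatrix A R X) A where
  toFun := blift R (fun φ u => φ u) (fun _ _ _ => rfl) (fun φ u v => map_add φ u v)
    (fun _ _ _ => rfl)
  map_add' := map_add _
  map_smul' a z := by
    induction z using btensor_induction with
    | h0 => simp
    | ht φ u => rfl
    | ha x y hx hy => simp only [smul_add, map_add, hx, hy]
  map_op_smul' a z := by
    induction z using btensor_induction with
    | h0 => simp
    | ht φ u => exact map_smul φ (op a) u
    | ha x y hx hy => simp only [smul_add, map_add, hx, hy]

theorem evalMap_btmul (φ : Dual A X) (u : X) : evalMap A R X (btmul R φ u) = φ u := rfl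

variable {A R X}

namespace FirmlyProjective

/-- The map `z ↦ e ⊗ ((f ⊗ x) ⊗ y)` for `w = x ⊗ y`, `z = e ⊗ f`. -/
def auxR (w : ATensor A X (Comatrix A R X)) :
    Elem A X →+ ATensor A X (ATensor A (Comatrix A R X) (Comatrix A R X)) :=
  blift A (fun e f => btmul A e (bmap (tensL (R := R) f) LinearMap.id w))
    (fun _ _ _ => add_btmul _ _ _ _)
    (fun e f f' => by rw [bmap_tensL_add, btmul_add])
    (fun a e f => by rw [btmul_balanced, bmap_tensL_smul])

theorem auxR_btmul (w : ATensor A X (Comatrix A R X)) (e : X) (f : Dual A X) :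
    auxR w (btmul A e f) = btmul A e (bmap (tensL (R := R) f) LinearMap.id w) := rfl

theorem auxR_zero (z : Elem A X) : auxR (0 : ATensor A X (Comatrix A R X)) z = 0 := by
  induction z using btensor_induction with
  | h0 => rw [map_zero]
  | ht e f => rw [auxR_btmul, map_zero, btmul_zero]
  | ha x y hx hy => rw [map_add, hx, hy, add_zero]

theorem auxR_add (w w' : ATensor A X (Comatrix A R X)) (z : Elem A X) :
    auxR (w + w') z = auxR w z + auxR w' z := by
  induction z using btensor_induction with
  | h0 => rw [map_zero, map_zero, map_zero, add_zero]
  | ht e f => rw [auxR_btmul, auxR_btmul, auxR_btmul, map_add, btmul_add]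
  | ha x y hx hy => rw [map_add, map_add, map_add, hx, hy]; abel

theorem auxR_assoc (z : Elem A X) (x : X) (y : Comatrix A R X) :
    bassoc (A := A) X (Comatrix A R X) (Comatrix A R X)
      (btmul A (bmap LinearMap.id (tensR (R := R) x) z) y) = auxR (btmul A x y) z := by
  induction z using btensor_induction with
  | h0 => rw [map_zero, map_zero, zero_btmul, map_zero]
  | ht e f => rfl
  | ha u v hu hv => rw [map_add, map_add, add_btmul, map_add, hu, hv]

theorem bmap_comul_eq (P : FirmlyProjective A X R) (u : X) (z : Elem A X) :
    bmap LinearMap.id P.comul.left (bmap LinearMap.id (tensR (R := R) u) z) =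
      auxR (P.coact u) z := by
  induction z using btensor_induction with
  | h0 => rw [map_zero, map_zero, map_zero]
  | ht e f => rfl
  | ha x y hx hy => rw [map_add, map_add, map_add, hx, hy]

theorem bmap_coact_eq (P : FirmlyProjective A X R) (r : R)
    (w : ATensor A X (Comatrix A R X)) :
    bassoc (A := A) X (Comatrix A R X) (Comatrix A R X)
      (bmap P.coact LinearMap.id (bmap (lact A r) LinearMap.id w)) = auxR w (P.ιAdd r) := by
  induction w using btensor_induction with
  | h0 => rw [map_zero, map_zero, map_zero, auxR_zero]
  | ht e f =>
    rw [bmap_btmul, bmap_btmul, lact_apply, P.coact_smul, ← auxR_assoc]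
    rfl
  | ha x y hx hy => rw [map_add, map_add, map_add, hx, hy, auxR_add]

theorem coact_coassoc (P : FirmlyProjective A X R) (x : X) :
    bassoc (A := A) X (Comatrix A R X) (Comatrix A R X)
      (bmap P.coact LinearMap.id (P.coact x)) =
      bmap LinearMap.id P.comul.left (P.coact x) := by
  induction x using P.smul_induction with
  | h0 => rw [map_zero, map_zero, map_zero, map_zero]
  | hs r u =>
    conv_lhs => rw [P.coact_smul_left, P.bmap_coact_eq]
    rw [P.coact_smul, P.bmap_comul_eq]
  | ha x y hx hy => rw [map_add, map_add, map_add, map_add, hx, hy]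

theorem comul_coassoc_aux (P : FirmlyProjective A X R) (φ : Dual A X)
    (w : ATensor A X (Comatrix A R X)) :
    bassoc (A := A) (Comatrix A R X) (Comatrix A R X) (Comatrix A R X)
      (bmap P.comul.right LinearMap.id (bmap (tensL (R := R) φ) LinearMap.id w)) =
    bmap (tensL (R := R) φ) LinearMap.id
      (bassoc (A := A) X (Comatrix A R X) (Comatrix A R X) (bmap P.coact LinearMap.id w)) := by
  induction w using btensor_induction with
  | h0 => simp only [map_zero]
  | ht e d =>
    change bassoc (A := A) (Comatrix A R X) (Comatrix A R X) (Comatrix A R X)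
      (btmul A (bmap (tensL (R := R) φ) LinearMap.id (P.coact e)) d) =
      bmap (tensL (R := R) φ) LinearMap.id
      (bassoc (A := A) X (Comatrix A R X) (Comatrix A R X) (btmul A (P.coact e) d))
    generalize P.coact e = v
    induction v using btensor_induction with
    | h0 => simp only [map_zero, zero_btmul]
    | ht x y => rfl
    | ha x y hx hy => simp only [map_add, add_btmul, hx, hy]
  | ha x y hx hy => simp only [map_add, hx, hy]

theorem counit_left_aux (φ : Dual A X) (u : X) (z : Elem A X) :
    lunit (A := A) (Comatrix A R X) (bmap (evalMap A R X).right LinearMap.id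
      (bmap (tensL (R := R) φ) LinearMap.id (bmap LinearMap.id (tensR (R := R) u) z))) =
    btmul R (φ.comp (elemAct z) : Dual A X) u := by
  induction z using btensor_induction with
  | h0 => simp only [map_zero, LinearMap.comp_zero, zero_btmul]
  | ht e f =>
    change φ e • btmul R f u = _
    rw [smul_btmul]
    congr 1
    ext x
    simp
  | ha x y hx hy => simp only [map_add, LinearMap.comp_add, add_btmul, hx, hy]

theorem counit_right_aux (φ : Dual A X) (u : X) (z : Elem A X) :
    runit (A := A) (Comatrix A R X) (bmap LinearMap.id (evalMap A R X).left
      (bmap (tensL (R := R) φ) LinearMap.id (bmap LinearMap.id (tensR (R := R) u) z))) =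
    btmul R φ (elemAct z u) := by
  induction z using btensor_induction with
  | h0 => simp only [map_zero, LinearMap.zero_apply, btmul_zero]
  | ht e f => rfl
  | ha x y hx hy => simp only [map_add, LinearMap.add_apply, btmul_add, hx, hy]

/-- The comatrix coring `X^* ⊗_R X` of an `R`-firmly projective bimodule `X`, with
`Δ(φ ⊗ u) = (φ ⊗ e_r) ⊗ (f_r ⊗ u^r)` and `ε(φ ⊗ u) = φ(u)`. -/
noncomputable def comatrixCoring (P : FirmlyProjective A X R) : Coring A (Comatrix A R X) where
  comul := P.comul
  counit := evalMap A R X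
  coassoc z := by
    induction z using btensor_induction with
    | h0 => simp only [BimodHom.map_zero, map_zero]
    | ht φ u =>
      rw [P.comul_btmul, P.comul_coassoc_aux, P.coact_coassoc]
      generalize P.coact u = w
      induction w using btensor_induction with
      | h0 => simp only [map_zero]
      | ht e d => rfl
      | ha x y hx hy => simp only [map_add, hx, hy]
    | ha x y hx hy => simp only [BimodHom.map_add, map_add, hx, hy]
  counit_left z := by
    induction z using btensor_induction with
    | h0 => simp only [BimodHom.map_zero, map_zero]
    | ht φ u =>
      induction u using P.smul_induction with
      | h0 => simp only [btmul_zero, BimodHom.map_zero, map_zero]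
      | hs r v =>
        rw [P.comul_btmul, P.coact_smul, counit_left_aux, elemAct_ιAdd, ← btmul_balanced]
        rfl
      | ha x y hx hy => simp only [btmul_add, BimodHom.map_add, map_add, hx, hy]
    | ha x y hx hy => simp only [BimodHom.map_add, map_add, hx, hy]
  counit_right z := by
    induction z using btensor_induction with
    | h0 => simp only [BimodHom.map_zero, map_zero]
    | ht φ u =>
      induction u using P.smul_induction with
      | h0 => simp only [btmul_zero, BimodHom.map_zero, map_zero]
      | hs r v =>
        rw [P.comul_btmul, P.coact_smul, counit_right_aux, elemAct_ιAdd, lact_apply]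
      | ha x y hx hy => simp only [btmul_add, BimodHom.map_add, map_add, hx, hy]
    | ha x y hx hy => simp only [BimodHom.map_add, map_add, hx, hy]

end FirmlyProjective

end Comatrix

/-! ### Galois and comonadic-Galois comodules -/

section Galois

variable {A R C X : Type*} [Ring A] [NonUnitalRing R]
  [AddCommGroup C] [Module A C] [Module Aᵐᵒᵖ C] [SMulCommClass A Aᵐᵒᵖ C]
  [AddCommGroup X] [Module Aᵐᵒᵖ X] [NonUnitalModule R X] [SMulCommClass R Aᵐᵒᵖ X]

/-- An `R`-`𝒞` bicomodule structure on the `R`-`A`-bimodule `X`: a right `𝒞`-comodule structure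
whose coaction is left `R`-linear. -/
structure Bicomodule (R : Type*) {A C : Type*} [Ring A] [NonUnitalRing R]
    [AddCommGroup C] [Module A C] [Module Aᵐᵒᵖ C] [SMulCommClass A Aᵐᵒᵖ C]
    (𝒞 : Coring A C) (X : Type*) [AddCommGroup X] [Module Aᵐᵒᵖ X] [NonUnitalModule R X]
    [SMulCommClass R Aᵐᵒᵖ X] extends Comodule 𝒞 X where
  coact_smul : ∀ (r : R) (x : X), coact (r • x) = bmap (lact A r) LinearMap.id (coact x)

variable {𝒞 : Coring A C}

theorem Bicomodule.coact_balanced (ρ : Bicomodule R 𝒞 X) {M : Type*} [AddCommGroup M]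
    [Module Aᵐᵒᵖ M] (r : R) (f : X →ₗ[Aᵐᵒᵖ] M) (u : X) :
    bmap (op r • f) (LinearMap.id : C →ₗ[A] C) (ρ.coact u) =
      bmap f LinearMap.id (ρ.coact (r • u)) := by
  rw [ρ.coact_smul]
  generalize ρ.coact u = w
  induction w using btensor_induction with
  | h0 => simp only [map_zero]
  | ht x c => rfl
  | ha x y hx hy => simp only [map_add, hx, hy]

theorem bmap_add_left {M : Type*} [AddCommGroup M] [Module Aᵐᵒᵖ M] (f g : X →ₗ[Aᵐᵒᵖ] M)
    (w : ATensor A X C) :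
    bmap (f + g) LinearMap.id w = bmap f LinearMap.id w + bmap g LinearMap.id w := by
  induction w using btensor_induction with
  | h0 => simp only [map_zero, add_zero]
  | ht x c => simp only [bmap_btmul, LinearMap.add_apply, add_btmul]
  | ha x y hx hy => simp only [map_add, hx, hy]; abel

theorem bmap_op_smul {M : Type*} [AddCommGroup M] [Module Aᵐᵒᵖ M] (f : X →ₗ[Aᵐᵒᵖ] M) (a : Aᵐᵒᵖ)
    (w : ATensor A X C) :
    bmap f (LinearMap.id : C →ₗ[A] C) (a • w) = a • bmap f LinearMap.id w := by
  induction w using btensor_induction with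
  | h0 => simp only [map_zero, smul_zero]
  | ht x c => rfl
  | ha x y hx hy => simp only [map_add, smul_add, hx, hy]

/-- The map `can_M : Hom_A(X, M) ⊗_R X → M ⊗_A C`, `f ⊗ u ↦ f(u_[0]) ⊗ u_[1]`, additively. -/
def canMAux (ρ : Bicomodule R 𝒞 X) (M : Type*) [AddCommGroup M] [Module Aᵐᵒᵖ M] :
    BTensor R (X →ₗ[Aᵐᵒᵖ] M) X →+ ATensor A M C :=
  blift R (fun f u => bmap f LinearMap.id (ρ.coact u))
    (fun f g u => bmap_add_left f g _)
    (fun f u v => by rw [map_add, map_add])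
    (fun r f u => ρ.coact_balanced r f u)

/-- The right `A`-linear map `can_M : Hom_A(X, M) ⊗_R X → M ⊗_A C`,
`f ⊗ u ↦ f(u_[0]) ⊗ u_[1]`. -/
def canM (ρ : Bicomodule R 𝒞 X) (M : Type*) [AddCommGroup M] [Module Aᵐᵒᵖ M] :
    BTensor R (X →ₗ[Aᵐᵒᵖ] M) X →ₗ[Aᵐᵒᵖ] ATensor A M C where
  toFun := canMAux ρ M
  map_add' := map_add _
  map_smul' a z := by
    induction z using btensor_induction with
    | h0 => simp only [map_zero, smul_zero]
    | ht f u =>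
      change bmap f LinearMap.id (ρ.coact (a • u)) = a • bmap f LinearMap.id (ρ.coact u)
      rw [map_smul, bmap_op_smul]
    | ha x y hx hy => simp only [map_add, smul_add, hx, hy]

theorem canM_btmul (ρ : Bicomodule R 𝒞 X) (M : Type*) [AddCommGroup M] [Module Aᵐᵒᵖ M]
    (f : X →ₗ[Aᵐᵒᵖ] M) (u : X) :
    canM ρ M (btmul R f u) = bmap f LinearMap.id (ρ.coact u) := rfl

theorem lunit_smul (a : A) (w : ATensor A A C) :
    lunit (A := A) C (a • w) = a • lunit (A := A) C w := by
  induction w using btensor_induction with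
  | h0 => simp only [map_zero, smul_zero]
  | ht b c =>
    rw [smul_btmul, lunit_btmul, lunit_btmul, smul_eq_mul, mul_smul]
  | ha x y hx hy => simp only [map_add, smul_add, hx, hy]

theorem lunit_op_smul (a : A) (w : ATensor A A C) :
    lunit (A := A) C (op a • w) = op a • lunit (A := A) C w := by
  induction w using btensor_induction with
  | h0 => simp only [map_zero, smul_zero]
  | ht b c => rw [op_smul_btmul, lunit_btmul, lunit_btmul, smul_comm]
  | ha x y hx hy => simp only [map_add, smul_add, hx, hy]

theorem bmap_smul_left (a : A) (f : Dual A X) (w : ATensor A X C) :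
    bmap (a • f) (LinearMap.id : C →ₗ[A] C) w = a • bmap f LinearMap.id w := by
  induction w using btensor_induction with
  | h0 => simp only [map_zero, smul_zero]
  | ht x c => rfl
  | ha x y hx hy => simp only [map_add, smul_add, hx, hy]

/-- The canonical `A`-bilinear map `can : X^* ⊗_R X → C`, `f ⊗ u ↦ f(u_[0]) u_[1]`. -/
def can (ρ : Bicomodule R 𝒞 X) : BimodHom A (Comatrix A R X) C where
  toFun z := lunit (A := A) C (canM ρ A z)
  map_add' z w := by rw [map_add, map_add]
  map_smul' a z := by
    induction z using btensor_induction with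
    | h0 => simp only [map_zero, smul_zero]
    | ht f u =>
      rw [smul_btmul, canM_btmul, canM_btmul, bmap_smul_left, lunit_smul, RingHom.id_apply]
    | ha x y hx hy => simp only [map_add, smul_add, hx, hy]
  map_op_smul' a z := by rw [map_smul, lunit_op_smul]

/-- The `R`-firmly projective bicomodule `X` is an `R`-`𝒞` Galois comodule: the canonical map
`can` from the comatrix coring `X^* ⊗_R X` to `𝒞` is an isomorphism of corings. -/
def IsGalois (P : FirmlyProjective A X R) (ρ : Bicomodule R 𝒞 X) : Prop :=
  IsCoringHom P.comatrixCoring 𝒞 (can ρ) ∧ Function.Bijective (can ρ)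

end Galois

/-- The bicomodule `X` is an `R`-`𝒞` comonadic-Galois comodule: `can_M` is an isomorphism for
every right `A`-module `M`. -/
def IsComonadicGalois.{v, u, r, c, x} {A : Type u} {R : Type r} {C : Type c} {X : Type x}
    [Ring A] [NonUnitalRing R] [AddCommGroup C] [Module A C] [Module Aᵐᵒᵖ C]
    [SMulCommClass A Aᵐᵒᵖ C] [AddCommGroup X] [Module Aᵐᵒᵖ X] [NonUnitalModule R X]
    [SMulCommClass R Aᵐᵒᵖ X] {𝒞 : Coring A C} (ρ : Bicomodule R 𝒞 X) : Prop :=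
  ∀ (M : Type (max u v)) [AddCommGroup M] [Module Aᵐᵒᵖ M], Function.Bijective (canM ρ M)

end FirmGalois

universe u r c x v

/-! Write `ι r = e_r ⊗ f_r`. Firm projectivity makes the functor `Hom_A(X, -) ⊗_R X` a tensor
functor: the map `m ⊗ (φ ⊗ u) ↦ m φ(-) ⊗ u` from `M ⊗_A (X^* ⊗_R X)` to `Hom_A(X, M) ⊗_R X` is
bijective for every `M`. Its inverse sends `f ⊗ u` to `f(e_r) ⊗ (f_r ⊗ u^r)`. Since `X` is firm,
only vectors `u = r v` need checking, and there `u^r` disappears: the composite on the `Hom` side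
turns `f ⊗ r v` into `f(e_r) f_r(-) ⊗ v`, which is `f r ⊗ v = f ⊗ r v` because `e_r ⊗ f_r` acts on
`X` as `r` does (`homOfComatrix_bijective`).

Under this bijection `can_M` becomes `M ⊗_A can` (`canM_homOfComatrix`), so one is bijective exactly
when the other is (`canM_bijective_iff`). If `can` is bijective, so is every `M ⊗_A can`;
conversely, `M = A` recovers `can` itself.

The Galois condition also asks that `can` respect the coring structures. This holds without any
bijectivity (`can_isCoringHom`): the counit identity is counitality of the coaction, and the
comultiplication identity combines its coassociativity with its left `R`-linearity. -/

namespace FirmGalois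

/-! ### Tensoring an isomorphism, and recovering a map from its tensor product with `A` -/

section Unital

variable {A : Type*} [Ring A]

/-- The inverse of `g` is again left `A`-linear, so it can be tensored with `M`; no flatness is
involved. -/
theorem bmap_id_bijective {M N N' : Type*} [AddCommGroup M] [AddCommGroup N] [AddCommGroup N']
    [Module Aᵐᵒᵖ M] [Module A N] [Module A N'] (g : N →ₗ[A] N') (hg : Function.Bijective g) :
    Function.Bijective (bmap (LinearMap.id : M →ₗ[Aᵐᵒᵖ] M) g) := by
  let e := LinearEquiv.ofBijective g hg
  refine Function.bijective_iff_has_inverse.2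
    ⟨bmap (LinearMap.id : M →ₗ[Aᵐᵒᵖ] M) e.symm.toLinearMap, fun z => ?_, fun z => ?_⟩
  · induction z using btensor_induction with
    | h0 => simp only [map_zero]
    | ht m n => exact congrArg (btmul A m) (e.symm_apply_apply n)
    | ha x y hx hy => simp only [map_add, hx, hy]
  · induction z using btensor_induction with
    | h0 => simp only [map_zero]
    | ht m n => exact congrArg (btmul A m) (e.apply_symm_apply n)
    | ha x y hx hy => simp only [map_add, hx, hy]

/-- The map `A ⊗_A N → N`, `a ⊗ n ↦ a n`, for a lift of `A` to a larger universe. -/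
def ulunit.{l, a, w} (A : Type a) [Ring A] (N : Type w) [AddCommGroup N] [Module A N] :
    ATensor A (ULift.{l} A) N →+ N :=
  blift A (fun a n => a.down • n) (fun a a' n => add_smul a.down a'.down n)
    (fun a n n' => smul_add a.down n n')
    (fun s a n => mul_smul a.down s n)

/-- In the tensor product `a ⊗ n = 1 ⊗ a n`, so every element has the form `1 ⊗ n`. -/
theorem btmul_one_ulunit.{l, a, w} {A : Type a} [Ring A] {N : Type w} [AddCommGroup N]
    [Module A N] (z : ATensor A (ULift.{l} A) N) :
    btmul A (ULift.up 1) (ulunit.{l} A N z) = z := by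
  induction z using btensor_induction with
  | h0 => rw [map_zero, btmul_zero]
  | ht a n =>
    change btmul A (ULift.up 1) (a.down • n) = _
    rw [← btmul_balanced]
    congr 1
    exact ULift.ext _ _ (one_mul a.down)
  | ha x y hx hy => rw [map_add, btmul_add, hx, hy]

theorem btmul_one_bijective.{l, a, w} (A : Type a) [Ring A] (N : Type w) [AddCommGroup N]
    [Module A N] :
    Function.Bijective (fun n : N => (btmul A (ULift.up 1) n : ATensor A (ULift.{l} A) N)) :=
  Function.bijective_iff_has_inverse.2
    ⟨ulunit.{l} A N, fun n => one_smul A n, btmul_one_ulunit⟩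

/-- The bijections `n ↦ 1 ⊗ n` for `N` and `N'` intertwine `g` with `A ⊗ g`. The lift of `A` serves
to place the test module in the universe over which the comonadic condition quantifies. -/
theorem bijective_of_bmap_id_ulift.{l, a, w, w'} {A : Type a} [Ring A] {N : Type w} {N' : Type w'}
    [AddCommGroup N] [AddCommGroup N'] [Module A N] [Module A N'] (g : N →ₗ[A] N')
    (hg : Function.Bijective
      (bmap (LinearMap.id : ULift.{l} A →ₗ[Aᵐᵒᵖ] ULift.{l} A) g)) :
    Function.Bijective g :=
  ((btmul_one_bijective.{l} A N').of_comp_iff' g).1 (hg.comp (btmul_one_bijective.{l} A N))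

end Unital

/-! ### The isomorphism between `M ⊗_A (X^* ⊗_R X)` and `Hom_A(X, M) ⊗_R X` -/

section Reduction

variable {A R X M : Type*} [Ring A] [NonUnitalRing R] [AddCommGroup X]
  [Module Aᵐᵒᵖ X] [NonUnitalModule R X] [SMulCommClass R Aᵐᵒᵖ X] [AddCommGroup M] [Module Aᵐᵒᵖ M]

/-- The right `A`-linear map `v ↦ m φ(v)`. -/
def homOfDual (m : M) (φ : Dual A X) : X →ₗ[Aᵐᵒᵖ] M where
  toFun v := op (φ v) • m
  map_add' v w := by rw [map_add, op_add, add_smul]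
  map_smul' a v := by
    rw [map_smul, RingHom.id_apply, ← mul_smul]
    rfl

/-- For `m ∈ M`, the map `X^* ⊗_R X → Hom_A(X, M) ⊗_R X`, `φ ⊗ u ↦ m φ ⊗ u`. -/
def homOfComatrixAux (m : M) : Comatrix A R X →+ BTensor R (X →ₗ[Aᵐᵒᵖ] M) X :=
  blift R (fun φ u => btmul R (homOfDual m φ) u)
    (fun φ ψ u => by
      rw [← add_btmul]
      congr 1
      ext v
      exact add_smul (op (φ v)) (op (ψ v)) m)
    (fun φ u v => btmul_add R _ u v)
    (fun r φ u => btmul_balanced R r (homOfDual m φ) u)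

/-- The map `M ⊗_A (X^* ⊗_R X) → Hom_A(X, M) ⊗_R X`, `m ⊗ (φ ⊗ u) ↦ m φ ⊗ u`. -/
def homOfComatrix (A R X M : Type*) [Ring A] [NonUnitalRing R] [AddCommGroup X]
    [Module Aᵐᵒᵖ X] [NonUnitalModule R X] [SMulCommClass R Aᵐᵒᵖ X] [AddCommGroup M]
    [Module Aᵐᵒᵖ M] : ATensor A M (Comatrix A R X) →+ BTensor R (X →ₗ[Aᵐᵒᵖ] M) X :=
  blift A (fun m z => homOfComatrixAux m z)
    (fun m m' z => by
      induction z using btensor_induction with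
      | h0 => simp only [map_zero, add_zero]
      | ht φ u =>
        refine Eq.trans ?_ (add_btmul R (homOfDual m φ) (homOfDual m' φ) u)
        refine congrArg (btmul R · u) ?_
        ext v
        exact smul_add _ m m'
      | ha x y hx hy => simp only [map_add, hx, hy]; abel)
    (fun m z z' => map_add _ z z')
    (fun a m z => by
      induction z using btensor_induction with
      | h0 => simp only [map_zero, smul_zero]
      | ht φ u =>
        refine congrArg (btmul R · u) ?_
        ext v
        -- Balancedness over `A`: `(m a) φ(v) = m (a φ(v))`.
        exact smul_smul (op (φ v)) (op a) m
      | ha x y hx hy => simp only [map_add, smul_add, hx, hy])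

theorem homOfComatrix_btmul (m : M) (φ : Dual A X) (u : X) :
    homOfComatrix A R X M (btmul A m (btmul R φ u)) = btmul R (homOfDual m φ) u := rfl

/-- For `z = e ⊗ φ`, right `A`-linearity gives `f(e) φ(v) = f(e φ(v)) = f(z v)`. At `z = ι r` the
right-hand side becomes `f r ⊗ u`. -/
theorem homOfComatrix_bmap_tensR (f : X →ₗ[Aᵐᵒᵖ] M) (u : X) (z : Elem A X) :
    homOfComatrix A R X M (bmap f LinearMap.id (bmap LinearMap.id (tensR (R := R) u) z)) =
      btmul R (f.comp (elemAct z)) u := by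
  induction z using btensor_induction with
  | h0 => simp only [map_zero, LinearMap.comp_zero, zero_btmul]
  | ht e φ =>
    refine congrArg (btmul R · u) ?_
    ext v
    exact (map_smul f (op (φ v)) e).symm
  | ha x y hx hy => simp only [map_add, LinearMap.comp_add, add_btmul, hx, hy]

/-- The scalar `φ(e)` crosses the tensor sign: `m φ(e) ⊗ (ψ ⊗ u) = m ⊗ (φ(e) ψ ⊗ u)`, and `φ(e) ψ`
is `φ` composed with the action of `e ⊗ ψ`. -/
theorem bmap_homOfDual_tensR (m : M) (φ : Dual A X) (u : X) (z : Elem A X) :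
    bmap (homOfDual m φ) LinearMap.id (bmap LinearMap.id (tensR (R := R) u) z) =
      btmul A m (btmul R (φ.comp (elemAct z) : Dual A X) u) := by
  induction z using btensor_induction with
  | h0 => simp only [map_zero, LinearMap.comp_zero, zero_btmul, btmul_zero]
  | ht e ψ =>
    change btmul A (op (φ e) • m) (btmul R ψ u) = _
    rw [btmul_balanced, smul_btmul]
    congr 2
    ext v
    simp
  | ha x y hx hy => simp only [map_add, LinearMap.comp_add, add_btmul, btmul_add, hx, hy]

namespace FirmlyProjective

/-- The map `Hom_A(X, M) ⊗_R X → M ⊗_A (X^* ⊗_R X)`, `f ⊗ u ↦ f(e_r) ⊗ (f_r ⊗ u^r)`. -/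
noncomputable def comatrixOfHom (P : FirmlyProjective A X R) (M : Type*) [AddCommGroup M]
    [Module Aᵐᵒᵖ M] : BTensor R (X →ₗ[Aᵐᵒᵖ] M) X →+ ATensor A M (Comatrix A R X) :=
  blift R (fun f u => bmap f LinearMap.id (P.coact u))
    (fun f g u => bmap_add_left f g _)
    (fun f u v => by rw [map_add, map_add])
    (fun r f u => by
      -- Balancedness over `R` comes from the left `R`-linearity of the coaction of the comatrix
      -- coring.
      rw [coact_smul_left]
      generalize P.coact u = w
      induction w using btensor_induction with
      | h0 => simp only [map_zero]
      | ht x c => rfl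
      | ha x y hx hy => simp only [map_add, hx, hy])

theorem comatrixOfHom_btmul (P : FirmlyProjective A X R) (f : X →ₗ[Aᵐᵒᵖ] M) (u : X) :
    P.comatrixOfHom M (btmul R f u) = bmap f LinearMap.id (P.coact u) := rfl

theorem homOfComatrix_comatrixOfHom (P : FirmlyProjective A X R)
    (z : BTensor R (X →ₗ[Aᵐᵒᵖ] M) X) :
    homOfComatrix A R X M (P.comatrixOfHom M z) = z := by
  induction z using btensor_induction with
  | h0 => simp only [map_zero]
  | ht f u =>
    induction u using P.smul_induction with
    | h0 => simp only [btmul_zero, map_zero]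
    | hs r v =>
      -- Since `ι r` acts as `r`, the composite yields `f r ⊗ v`, which equals `f ⊗ r v`.
      rw [comatrixOfHom_btmul, coact_smul, homOfComatrix_bmap_tensR, elemAct_ιAdd,
        ← btmul_balanced]
      rfl
    | ha x y hx hy => simp only [btmul_add, map_add, hx, hy]
  | ha x y hx hy => simp only [map_add, hx, hy]

theorem comatrixOfHom_homOfComatrix (P : FirmlyProjective A X R)
    (z : ATensor A M (Comatrix A R X)) :
    P.comatrixOfHom M (homOfComatrix A R X M z) = z := by
  induction z using btensor_induction with
  | h0 => simp only [map_zero]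
  | ht m y =>
    induction y using btensor_induction with
    | h0 => simp only [btmul_zero, map_zero]
    | ht φ u =>
      induction u using P.smul_induction with
      | h0 => simp only [btmul_zero, map_zero]
      | hs r v =>
        -- Here the composite yields `m ⊗ (φ r ⊗ v) = m ⊗ (φ ⊗ r v)`, again because `ι r` acts as
        -- `r`.
        rw [homOfComatrix_btmul, comatrixOfHom_btmul, coact_smul, bmap_homOfDual_tensR,
          elemAct_ιAdd, ← btmul_balanced]
        rfl
      | ha x y hx hy => simp only [btmul_add, map_add, hx, hy]
    | ha x y hx hy => simp only [btmul_add, map_add, hx, hy]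
  | ha x y hx hy => simp only [map_add, hx, hy]

theorem homOfComatrix_bijective (P : FirmlyProjective A X R) :
    Function.Bijective (homOfComatrix A R X M) :=
  Function.bijective_iff_has_inverse.2
    ⟨P.comatrixOfHom M, P.comatrixOfHom_homOfComatrix, P.homOfComatrix_comatrixOfHom⟩

end FirmlyProjective

end Reduction

/-! ### Comparison of `can_M` with `M ⊗_A can` -/

section Galois

variable {A R C X : Type*} [Ring A] [NonUnitalRing R]
  [AddCommGroup C] [Module A C] [Module Aᵐᵒᵖ C] [SMulCommClass A Aᵐᵒᵖ C]
  [AddCommGroup X] [Module Aᵐᵒᵖ X] [NonUnitalModule R X] [SMulCommClass R Aᵐᵒᵖ X]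
  {𝒞 : Coring A C}

theorem can_btmul (ρ : Bicomodule R 𝒞 X) (φ : Dual A X) (u : X) :
    can ρ (btmul R φ u) = lunit (A := A) C (bmap φ LinearMap.id (ρ.coact u)) := rfl

theorem bmap_homOfDual {M : Type*} [AddCommGroup M] [Module Aᵐᵒᵖ M] (m : M) (φ : Dual A X)
    (w : ATensor A X C) :
    bmap (homOfDual m φ) LinearMap.id w =
      btmul A m (lunit (A := A) C (bmap φ LinearMap.id w)) := by
  induction w using btensor_induction with
  | h0 => simp only [map_zero, btmul_zero]
  | ht x c => exact btmul_balanced A (φ x) m c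
  | ha x y hx hy => simp only [map_add, btmul_add, hx, hy]

/-- On generators both sides are `m φ(u_[0]) ⊗ u_[1] = m ⊗ φ(u_[0]) u_[1]`. This identifies `can_M`
with `M ⊗_A can`. -/
theorem canM_homOfComatrix (ρ : Bicomodule R 𝒞 X) {M : Type*} [AddCommGroup M] [Module Aᵐᵒᵖ M]
    (z : ATensor A M (Comatrix A R X)) :
    canM ρ M (homOfComatrix A R X M z) = bmap LinearMap.id (can ρ).left z := by
  induction z using btensor_induction with
  | h0 => simp only [map_zero]
  | ht m y =>
    induction y using btensor_induction with
    | h0 => simp only [btmul_zero, map_zero]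
    | ht φ u => exact bmap_homOfDual m φ (ρ.coact u)
    | ha x y hx hy => simp only [btmul_add, map_add, hx, hy]
  | ha x y hx hy => simp only [map_add, hx, hy]

/-- `can_M` is bijective if and only if `M ⊗_A can` is. -/
theorem canM_bijective_iff (P : FirmlyProjective A X R) (ρ : Bicomodule R 𝒞 X)
    {M : Type*} [AddCommGroup M] [Module Aᵐᵒᵖ M] :
    Function.Bijective (canM ρ M) ↔
      Function.Bijective (bmap (LinearMap.id : M →ₗ[Aᵐᵒᵖ] M) (can ρ).left) := by
  -- Precomposing `can_M` with a bijection does not affect its bijectivity.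
  rw [← Function.Bijective.of_comp_iff _ P.homOfComatrix_bijective]
  exact iff_of_eq (congrArg Function.Bijective (funext (canM_homOfComatrix ρ)))

/-! ### The canonical map is a morphism of corings -/

/-- For `w = x ⊗ c`, linearity of `ε` and then of `φ` gives `ε(φ(x) c) = φ(x) ε(c) = φ(x ε(c))`. At
`w = ρ(u)` counitality reduces the last term to `φ(u)`. -/
theorem counit_lunit_bmap (φ : Dual A X) (w : ATensor A X C) :
    𝒞.counit (lunit (A := A) C (bmap φ LinearMap.id w)) =
      φ (runit (A := A) X (bmap LinearMap.id 𝒞.counit.left w)) := by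
  induction w using btensor_induction with
  | h0 => simp only [map_zero, BimodHom.map_zero]
  | ht x c =>
    exact (map_smul 𝒞.counit.left (φ x) c).trans (map_smul φ (op (𝒞.counit c)) x).symm
  | ha x y hx hy => simp only [map_add, BimodHom.map_add, hx, hy]

theorem can_counit (ρ : Bicomodule R 𝒞 X) (z : Comatrix A R X) :
    𝒞.counit (can ρ z) = evalMap A R X z := by
  induction z using btensor_induction with
  | h0 => simp only [BimodHom.map_zero]
  | ht φ u => rw [can_btmul, counit_lunit_bmap, ρ.counit, evalMap_btmul]
  | ha x y hx hy => simp only [BimodHom.map_add, hx, hy]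

/-- The map `v ↦ φ(v_[0]) v_[1]` for `φ ∈ X^*`. -/
def canLeft (ρ : Bicomodule R 𝒞 X) (φ : Dual A X) : X →ₗ[Aᵐᵒᵖ] C :=
  (can ρ).right.comp (tensL (R := R) φ)

theorem comul_lunit_bmap (φ : Dual A X) (w : ATensor A X C) :
    𝒞.comul (lunit (A := A) C (bmap φ LinearMap.id w)) =
      lunit (A := A) (ATensor A C C)
        (bmap φ LinearMap.id (bmap LinearMap.id 𝒞.comul.left w)) := by
  induction w using btensor_induction with
  | h0 => simp only [map_zero, BimodHom.map_zero]
  | ht x c => exact map_smul 𝒞.comul.left (φ x) c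
  | ha x y hx hy => simp only [map_add, BimodHom.map_add, hx, hy]

theorem lunit_bmap_bassoc (φ : Dual A X) (w : ATensor A X C) (c : C) :
    lunit (A := A) (ATensor A C C)
        (bmap φ LinearMap.id (bassoc (A := A) X C C (btmul A w c))) =
      btmul A (lunit (A := A) C (bmap φ LinearMap.id w)) c := by
  induction w using btensor_induction with
  | h0 => simp only [map_zero, zero_btmul]
  | ht x d => rfl
  | ha x y hx hy => simp only [map_add, add_btmul, hx, hy]

/-- At `w = ρ(u)` the left side carries one of the two sides of coassociativity: `φ(u_[0][0])
u_[0][1] ⊗ u_[1]`. -/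
theorem lunit_bmap_bassoc_coact (ρ : Bicomodule R 𝒞 X) (φ : Dual A X) (w : ATensor A X C) :
    lunit (A := A) (ATensor A C C)
        (bmap φ LinearMap.id (bassoc (A := A) X C C (bmap ρ.coact LinearMap.id w))) =
      bmap (canLeft ρ φ) LinearMap.id w := by
  induction w using btensor_induction with
  | h0 => simp only [map_zero]
  | ht x c => exact lunit_bmap_bassoc φ (ρ.coact x) c
  | ha x y hx hy => simp only [map_add, hx, hy]

/-- Left linearity of `Δ` gives `Δ(φ(u_[0]) u_[1]) = φ(u_[0]) Δ(u_[1])`, and coassociativity trades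
`Δ` for a second coaction on `u_[0]`. -/
theorem comul_can_btmul (ρ : Bicomodule R 𝒞 X) (φ : Dual A X) (u : X) :
    𝒞.comul (can ρ (btmul R φ u)) = bmap (canLeft ρ φ) LinearMap.id (ρ.coact u) := by
  rw [can_btmul, comul_lunit_bmap, ← ρ.coassoc, lunit_bmap_bassoc_coact]

/-- For `z = e ⊗ ψ`: `g(e) ⊗ ψ(v_[0]) v_[1] = g(e ψ(v_[0])) ⊗ v_[1]`. Thus applying `can` in the
second factor absorbs `z` into its action on `X`. -/
theorem bmap_elemAct {M : Type*} [AddCommGroup M] [Module Aᵐᵒᵖ M] (ρ : Bicomodule R 𝒞 X)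
    (g : X →ₗ[Aᵐᵒᵖ] M) (v : X) (z : Elem A X) :
    bmap g (can ρ).left (bmap LinearMap.id (tensR (R := R) v) z) =
      bmap (g.comp (elemAct z)) LinearMap.id (ρ.coact v) := by
  induction z using btensor_induction with
  | h0 =>
    have h (w : ATensor A X C) : bmap (0 : X →ₗ[Aᵐᵒᵖ] M) LinearMap.id w = 0 := by
      simpa using bmap_add_left (0 : X →ₗ[Aᵐᵒᵖ] M) 0 w
    simp only [map_zero, LinearMap.comp_zero, h]
  | ht e ψ =>
    refine (bmap_homOfDual (g e) ψ (ρ.coact v)).symm.trans ?_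
    congr 2
    ext x
    exact (map_smul g (op (ψ x)) e).symm
  | ha x y hx hy => simp only [map_add, LinearMap.comp_add, bmap_add_left, hx, hy]

theorem bmap_can_tensL (ρ : Bicomodule R 𝒞 X) (φ : Dual A X)
    (w : ATensor A X (Comatrix A R X)) :
    bmap (can ρ).right (can ρ).left (bmap (tensL (R := R) φ) LinearMap.id w) =
      bmap (canLeft ρ φ) (can ρ).left w := by
  induction w using btensor_induction with
  | h0 => simp only [map_zero]
  | ht x c => rfl
  | ha x y hx hy => simp only [map_add, hx, hy]

theorem can_comul (P : FirmlyProjective A X R) (ρ : Bicomodule R 𝒞 X) (z : Comatrix A R X) :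
    𝒞.comul (can ρ z) = bmap (can ρ).right (can ρ).left (P.comul z) := by
  induction z using btensor_induction with
  | h0 => simp only [BimodHom.map_zero, map_zero]
  | ht φ u =>
    induction u using P.smul_induction with
    | h0 => simp only [btmul_zero, BimodHom.map_zero, map_zero]
    | hs r v =>
      -- With `g = canLeft ρ φ`, the comatrix side becomes `g(r v_[0]) ⊗ v_[1]`. Left `R`-linearity
      -- of `ρ` equates this with `g((r v)_[0]) ⊗ (r v)_[1]`, the value of `Δ` on `can(φ ⊗ r v)`.
      rw [comul_can_btmul, P.comul_btmul, P.coact_smul, bmap_can_tensL, bmap_elemAct,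
        P.elemAct_ιAdd, ← ρ.coact_balanced]
      rfl
    | ha x y hx hy => simp only [btmul_add, BimodHom.map_add, map_add, hx, hy]
  | ha x y hx hy => simp only [BimodHom.map_add, map_add, hx, hy]

/-- The canonical map from the comatrix coring is always a morphism of corings. -/
theorem can_isCoringHom (P : FirmlyProjective A X R) (ρ : Bicomodule R 𝒞 X) :
    IsCoringHom P.comatrixCoring 𝒞 (can ρ) where
  map_comul := can_comul P ρ
  map_counit := can_counit ρ

end Galois

end FirmGalois

/-! ### The equivalence -/

theorem theorem4p2 {A : Type u} {R : Type r} {C : Type c} {X : Type x}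
    [Ring A] [NonUnitalRing R]
    [AddCommGroup C] [Module A C] [Module Aᵐᵒᵖ C] [SMulCommClass A Aᵐᵒᵖ C]
    [AddCommGroup X] [Module Aᵐᵒᵖ X] [FirmGalois.NonUnitalModule R X] [SMulCommClass R Aᵐᵒᵖ X]
    (hR : FirmGalois.IsFirmRing R)
    (𝒞 : FirmGalois.Coring A C) (ρ : FirmGalois.Bicomodule R 𝒞 X)
    (P : FirmGalois.FirmlyProjective A X R) :
    FirmGalois.IsGalois P ρ ↔ FirmGalois.IsComonadicGalois.{v} ρ := by
  constructor
  · rintro ⟨-, h⟩ M _ _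
    exact (FirmGalois.canM_bijective_iff P ρ).2 (FirmGalois.bmap_id_bijective _ h)
  · intro h
    -- Only bijectivity of `can` draws on the hypothesis, and only at the single module `M = A`, up
    -- to a universe lift.
    exact ⟨FirmGalois.can_isCoringHom P ρ,
      FirmGalois.bijective_of_bmap_id_ulift.{v} (FirmGalois.can ρ).left
      ((FirmGalois.canM_bijective_iff P ρ).1 (h (ULift.{v} A)))⟩
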